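/- Let $m\ge 1$ and let $A\in\mathbb{R}^{m\times m}$ be a normal matrix, $AA^*=A^*A$, with eigenvalues $\lambda_1,\dots,\lambda_m\in\mathbb{C}$ (counted with multiplicity) ordered such that $0<\mathsf{Re}(\lambda_1)\le\mathsf{Re}(\lambda_2)\le\dots\le\mathsf{Re}(\lambda_m)$, and let $v_1,\dots,v_m$ be an orthonormal basis of $\mathbb{C}^m$ with $Av_j=\lambda_jv_j$. (This includes the case of a positive definite symmetric matrix $A$.) Let $B$ be a standard Brownian motion in $\mathbb{R}^m$ and, for $x\in\mathbb{R}^m$, let $(X_t(x))_{t\ge 0}$ be the solution of $$\mathrm{d}X_t(x)=-AX_t(x)\,\mathrm{d}t+\mathrm{d}B_t,\qquad X_0(x)=x.$$ Let $\mu$ be the stationary probability distribution of this equation. Let $\mathcal{W}_2$ be the Wasserstein distance of order $2$ on $\mathbb{R}^m$, $$\mathcal{W}_2(\mu_1,\mu_2)=\Big(\inf_{\mathcal{T}}\int_{\mathbb{R}^m\times\mathbb{R}^m}|u-v|^2\,\mathcal{T}(\mathrm{d}u,\mathrm{d}v)\Big)^{1/2},$$ the infimum being over all joint distributions $\mathcal{T}$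 of $\mu_1$ and $\mu_2$, where a random variable in place of a measure stands for its law. Fix $x\in\mathbb{R}^m$. Then $\mathcal{W}_2(X_t(x),\mu)<\infty$ for all $t\ge 0$, and the following holds. 1. If $x\ne0$ and $\langle x,v_1\rangle\neq 0$, then for $t_\varepsilon:=\frac{1}{\mathsf{Re}(\lambda_1)}|\ln\varepsilon|$ $$\lim_{\varepsilon\to 0+}\frac{\mathcal{W}_2(X_{\delta\cdot t_\varepsilon}(x),\mu)}{\varepsilon}=\begin{cases}\infty&\text{for }\delta\in(0,1),\\0&\text{for }\delta>1.\end{cases}\qquad(*)$$ 2. If $x\neq 0$, $\langle x,v_1\rangle=0$ and $$\rho:=\min\{\mathsf{Re}(\lambda_j): j\in\{1,\dots,m\},\ \langle x,v_j\rangle\neq 0\}<2\,\mathsf{Re}(\lambda_1),$$ then $(*)$ holds for $t_\varepsilon:=\frac1\rho|\ln\varepsilon|$. 3. If $x=0$, then $(*)$ holds for $t_\varepsilon:=\frac{1}{2\mathsf{Re}(\lambda_1)}|\ln\varepsilon|$. -/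

import Mathlib

open MeasureTheory ProbabilityTheory Filter Topology
open scoped NNReal ENNReal Matrix

noncomputable section

/-- `B` is an `n`-dimensional standard Brownian motion under `P`: its coordinates are independent
real standard Brownian motions (with almost surely continuous paths). -/
structure IsStandardBrownian {Ω : Type*} [MeasurableSpace Ω] {n : ℕ}
    (B : ℝ≥0 → Ω → EuclideanSpace ℝ (Fin n)) (P : Measure Ω) : Prop where
  coord : ∀ i, IsBrownianReal (fun t ω ↦ B t ω i) P
  indep : iIndepFun (fun (i : Fin n) (ω : Ω) (t : ℝ≥0) ↦ B t ω i) P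

/-- `X` is a solution with continuous paths of `dX_t = -A X_t dt + σ dL_t`, `X_0 = x`. The noise is
additive, so the equation is understood in its pathwise integrated form
`X_t = x - ∫_0^t A X_s ds + σ L_t` for all `t ≥ 0`. -/
structure IsOUSolution {Ω : Type*} [MeasurableSpace Ω] {m n : ℕ}
    (A : Matrix (Fin m) (Fin m) ℝ) (σ : Matrix (Fin m) (Fin n) ℝ)
    (L : ℝ≥0 → Ω → EuclideanSpace ℝ (Fin n)) (P : Measure Ω) (x : EuclideanSpace ℝ (Fin m))
    (X : ℝ≥0 → Ω → EuclideanSpace ℝ (Fin m)) : Prop where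
  aemeasurable : ∀ t, AEMeasurable (X t) P
  continuous : ∀ᵐ ω ∂P, Continuous (fun t ↦ X t ω)
  equation : ∀ᵐ ω ∂P, ∀ t : ℝ≥0,
    X t ω = x - (∫ s in (0 : ℝ)..t, A.toEuclideanLin (X s.toNNReal ω)) + σ.toEuclideanLin (L t ω)

/-- `μ` is a stationary (equilibrium) distribution of the Markov family `X`, where `X y` is the
process started in `y`: it is a probability measure and, for every `t`, starting from `μ` the
law at time `t` is `μ` again, i.e. `∫ P(X_t(y) ∈ ·) μ(dy) = μ`. -/
structure IsStationaryLaw {Ω E : Type*} [MeasurableSpace Ω] [MeasurableSpace E]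
    (P : Measure Ω) (X : E → ℝ≥0 → Ω → E) (μ : Measure E) : Prop where
  isProbabilityMeasure : IsProbabilityMeasure μ
  bind_eq : ∀ t, μ.bind (fun y ↦ P.map (X y t)) = μ

/-- The joint distributions (couplings) of `μ₁` and `μ₂`. -/
def couplings {E : Type*} [MeasurableSpace E] (μ₁ μ₂ : Measure E) : Set (Measure (E × E)) :=
  {γ | γ.map Prod.fst = μ₁ ∧ γ.map Prod.snd = μ₂}

/-- The Wasserstein-Kantorovich-Rubinstein distance of order `p > 0`, with values in `[0, ∞]`. -/
def wasserstein {E : Type*} [PseudoEMetricSpace E] [MeasurableSpace E] (p : ℝ)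
    (μ₁ μ₂ : Measure E) : ℝ≥0∞ :=
  (⨅ γ ∈ couplings μ₁ μ₂, ∫⁻ z, edist z.1 z.2 ^ p ∂γ) ^ min 1 (1 / p)

/-- Cutoff stability of the distance function `d` (distance to equilibrium as a function of time)
at the time scale `T`: as `ε → 0`, `ε > 0`, the quotient `d (δ * T ε) / ε` tends to `∞`
for `δ ∈ (0, 1)` and to `0` for `δ > 1`. -/
def CutoffStability (d : ℝ≥0 → ℝ) (T : ℝ → ℝ) : Prop :=
  (∀ δ : ℝ, 0 < δ → δ < 1 →
    Tendsto (fun ε : ℝ ↦ d (δ * T ε).toNNReal / ε) (𝓝[>] 0) atTop) ∧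
  (∀ δ : ℝ, 1 < δ →
    Tendsto (fun ε : ℝ ↦ d (δ * T ε).toNNReal / ε) (𝓝[>] 0) (𝓝 0))

/-- A real vector, seen in `ℂ^m`. -/
def toComplexVec {m : ℕ} (x : EuclideanSpace ℝ (Fin m)) : EuclideanSpace ℂ (Fin m) :=
  WithLp.toLp 2 (fun i ↦ (x i : ℂ))

end

/-!
All laws in sight are Gaussian. Variation of constants writes `⟨X_t, u⟩` as `⟨e^{-tA} x, u⟩` plus a
Wiener integral with a smooth integrand, which can be integrated by parts pathwise; its law is thus
the limit of laws of finite sums of independent Gaussian increments. For normal `A` one has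
`e^{-tA} e^{-tAᵀ} = e^{-t(A + Aᵀ)}`, so an orthonormal eigenbasis `w` of `A + Aᵀ`, with eigenvalues
`s k`, diagonalises the covariance of every `X_t` and of the equilibrium. Transporting two Gaussian
laws with commuting covariances through the same standard Gaussian vector attains the lower bound
given by the means and variances of the coordinates, whence the exact formula
`W₂(X_t, μ)² = ∑ k, (e^{-s k t} ⟨w k, x⟩² + (1 - √(1 - e^{-s k t}))² / s k)`.
It is comparable to `e^{-2 r t}`, where `r` is the least of the numbers `2 Re λⱼ` and of those
`Re λⱼ` whose eigenvector is seen by `x`; the cutoff at `|log ε| / r` follows.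
-/

section RiemannStieltjes

variable {F : Type*} [NormedAddCommGroup F] [InnerProductSpace ℝ F]

lemma norm_inner_sub_integral_inner_deriv_le [CompleteSpace F] {f h h' : ℝ → F} {a b η M : ℝ}
    {y : F} (hab : a ≤ b) (hf : Continuous f) (hh : ∀ s, HasDerivAt h (h' s) s)
    (hh' : Continuous h') (hfy : ∀ s ∈ Set.Icc a b, ‖y - f s‖ ≤ η)
    (hM : ∀ s ∈ Set.Icc a b, ‖h' s‖ ≤ M) :
    ‖inner ℝ y (h b - h a) - ∫ s in a..b, inner ℝ (f s) (h' s)‖ ≤ η * M * (b - a) := by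
  have hη : 0 ≤ η := (norm_nonneg _).trans (hfy a ⟨le_rfl, hab⟩)
  have hincr : inner ℝ y (h b - h a) = ∫ s in a..b, inner ℝ y (h' s) := by
    rw [← intervalIntegral.integral_eq_sub_of_hasDerivAt (fun s _ ↦ hh s)
      (hh'.intervalIntegrable _ _)]
    exact ((innerSL ℝ y).intervalIntegral_comp_comm (hh'.intervalIntegrable _ _)).symm
  rw [hincr, ← intervalIntegral.integral_sub
    ((continuous_const.inner hh').intervalIntegrable _ _)
    ((hf.inner hh').intervalIntegrable _ _), ← abs_of_nonneg (sub_nonneg.2 hab)]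
  refine intervalIntegral.norm_integral_le_of_norm_le_const fun s hs ↦ ?_
  have hs' : s ∈ Set.Icc a b := Set.Ioc_subset_Icc_self (Set.uIoc_of_le hab ▸ hs)
  rw [← inner_sub_left]
  exact (norm_inner_le_norm _ _).trans (mul_le_mul (hfy s hs') (hM s hs') (norm_nonneg _) hη)

lemma tendsto_sum_inner_increment [CompleteSpace F] {f h h' : ℝ → F} (hf : Continuous f)
    (hh : ∀ s, HasDerivAt h (h' s) s) (hh' : Continuous h') {t : ℝ} (ht : 0 ≤ t)
    {ξ : ℕ → ℕ → ℝ} (hξ : ∀ n k : ℕ, ξ n k ∈ Set.Icc (t * k / n) (t * (k + 1 : ℕ) / n)) :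
    Tendsto (fun n : ℕ ↦ ∑ k ∈ Finset.range n,
      inner ℝ (f (ξ n k)) (h (t * (k + 1 : ℕ) / n) - h (t * k / n))) atTop
      (𝓝 (∫ s in (0 : ℝ)..t, inner ℝ (f s) (h' s))) := by
  obtain ⟨M, hM⟩ := isCompact_Icc.exists_bound_of_continuousOn (s := Set.Icc 0 t) hh'.continuousOn
  have hM0 : 0 ≤ M := (norm_nonneg _).trans (hM 0 ⟨le_rfl, ht⟩)
  rw [Metric.tendsto_atTop]
  intro ε hε
  obtain ⟨η, hη, hηε⟩ : ∃ η > 0, η * M * t < ε := by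
    refine ⟨ε / (M * t + 1), by positivity, ?_⟩
    rw [mul_assoc, div_mul_eq_mul_div, div_lt_iff₀ (by positivity)]
    linarith
  obtain ⟨δ, hδ, hfδ⟩ := Metric.uniformContinuousOn_iff_le.1
    (isCompact_Icc.uniformContinuousOn_of_continuous (hf.continuousOn (s := Set.Icc 0 t))) η hη
  obtain ⟨N, hN⟩ := ((tendsto_const_div_atTop_nhds_zero_nat t).eventually_le_const hδ
    |>.and (eventually_gt_atTop 0)).exists_forall_of_atTop
  refine ⟨N, fun n hn ↦ ?_⟩
  obtain ⟨hnt, hn0⟩ := hN n hn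
  have hn0' : (0 : ℝ) < n := Nat.cast_pos.2 hn0
  have hmesh (k : ℕ) : t * (k + 1 : ℕ) / n - t * k / n = t / n := by push_cast; ring
  have hsplit : ∫ s in (0 : ℝ)..t, inner ℝ (f s) (h' s) = ∑ k ∈ Finset.range n,
      ∫ s in (t * k / n)..(t * (k + 1 : ℕ) / n), inner ℝ (f s) (h' s) := by
    rw [intervalIntegral.sum_integral_adjacent_intervals (a := fun k : ℕ ↦ t * k / n)
      fun k _ ↦ (hf.inner hh').intervalIntegrable _ _]
    simp [hn0'.ne']
  have hterm : ∀ k ∈ Finset.range n, ‖inner ℝ (f (ξ n k)) (h (t * (k + 1 : ℕ) / n) - h (t * k / n))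
      - ∫ s in (t * k / n)..(t * (k + 1 : ℕ) / n), inner ℝ (f s) (h' s)‖ ≤ η * M * (t / n) := by
    intro k hk
    have hsub : Set.Icc (t * k / n) (t * (k + 1 : ℕ) / n) ⊆ Set.Icc 0 t := by
      refine Set.Icc_subset_Icc (by positivity) ?_
      rw [div_le_iff₀ hn0']
      exact mul_le_mul_of_nonneg_left (by exact_mod_cast Finset.mem_range.1 hk) ht
    rw [← hmesh k]
    refine norm_inner_sub_integral_inner_deriv_le ((hξ n k).1.trans (hξ n k).2) hf hh hh'
      (fun s hs ↦ ?_) fun s hs ↦ hM s (hsub hs)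
    rw [← dist_eq_norm]
    exact hfδ _ (hsub (hξ n k)) _ (hsub hs)
      ((Real.dist_le_of_mem_Icc (hξ n k) hs).trans ((hmesh k).trans_le hnt))
  rw [dist_eq_norm, hsplit, ← Finset.sum_sub_distrib]
  refine ((norm_sum_le _ _).trans (Finset.sum_le_sum hterm)).trans_lt ?_
  rw [Finset.sum_const, Finset.card_range, nsmul_eq_mul, mul_left_comm, mul_div_cancel₀ t hn0'.ne']
  exact hηε

lemma tendsto_sum_increment_inner [CompleteSpace F] {b g g' : ℝ → F} (hb : Continuous b)
    (hb0 : b 0 = 0) (hg : ∀ s, HasDerivAt g (g' s) s) (hg' : Continuous g') {t : ℝ} (ht : 0 ≤ t) :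
    Tendsto (fun n : ℕ ↦ ∑ k ∈ Finset.range n,
      inner ℝ (b (t * (k + 1 : ℕ) / n) - b (t * k / n)) (g (t * k / n))) atTop
      (𝓝 (inner ℝ (b t) (g t) - ∫ s in (0 : ℝ)..t, inner ℝ (b s) (g' s))) := by
  have htag (n k : ℕ) : t * (k + 1 : ℕ) / n ∈ Set.Icc (t * k / n) (t * (k + 1 : ℕ) / n) :=
    ⟨by gcongr; omega, le_rfl⟩
  refine ((tendsto_const_nhds (x := inner ℝ (b t) (g t))).sub
    (tendsto_sum_inner_increment hb hg hg' ht htag)).congr' ?_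
  filter_upwards [eventually_gt_atTop 0] with n hn
  have hn0 : (n : ℝ) ≠ 0 := by exact_mod_cast hn.ne'
  have htele := Finset.sum_range_sub (fun k : ℕ ↦ inner ℝ (b (t * k / n)) (g (t * k / n))) n
  simp only [Nat.cast_zero, mul_zero, zero_div, hb0, inner_zero_left, sub_zero,
    mul_div_cancel_right₀ t hn0] at htele
  rw [← htele, ← Finset.sum_sub_distrib]
  refine Finset.sum_congr rfl fun k _ ↦ ?_
  rw [inner_sub_left, inner_sub_right]
  ring

lemma tendsto_sum_mul_mesh {f : ℝ → ℝ} (hf : Continuous f) {t : ℝ} (ht : 0 ≤ t) :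
    Tendsto (fun n : ℕ ↦ ∑ k ∈ Finset.range n, f (t * k / n) * (t / n)) atTop
      (𝓝 (∫ s in (0 : ℝ)..t, f s)) := by
  have htag (n k : ℕ) : t * k / n ∈ Set.Icc (t * k / n) (t * (k + 1 : ℕ) / n) :=
    ⟨le_rfl, by gcongr; omega⟩
  have := tendsto_sum_inner_increment hf hasDerivAt_id continuous_const ht htag
  simp only [id, RCLike.inner_apply, conj_trivial, one_mul, ← sub_div, ← mul_sub] at this
  simpa [mul_comm] using this

end RiemannStieltjes

section BrownianSums

variable {Ω : Type*} [MeasurableSpace Ω] {P : Measure Ω}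

lemma hasLaw_sum_gaussianReal {ι : Type*} {Y : ι → Ω → ℝ} {a : ι → ℝ} {v : ι → ℝ≥0}
    (hY : ∀ i, HasLaw (Y i) (gaussianReal (a i) (v i)) P) (hind : iIndepFun Y P) (s : Finset ι) :
    HasLaw (fun ω ↦ ∑ i ∈ s, Y i ω) (gaussianReal (∑ i ∈ s, a i) (∑ i ∈ s, v i)) P where
  aemeasurable := Finset.aemeasurable_fun_sum s fun i _ ↦ (hY i).aemeasurable
  map_eq := by
    have := hind.isProbabilityMeasure
    refine Measure.ext_of_charFun ?_
    rw [iIndepFun.charFun_map_fun_finsetSum_eq_prod (fun i _ ↦ (hY i).aemeasurable)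
      (hind.restrict _)]
    ext z
    simp only [Finset.prod_apply, (hY _).map_eq, charFun_gaussianReal, ← Complex.exp_sum]
    push_cast
    rw [Finset.sum_sub_distrib, Finset.mul_sum, Finset.sum_mul, Finset.sum_mul, Finset.sum_div]

lemma hasLaw_sum_mul_brownian_increment {b : ℝ≥0 → Ω → ℝ} (hb : IsPreBrownianReal b P)
    {τ : ℕ → ℝ≥0} (hτ : Monotone τ) (c : ℕ → ℝ) (n : ℕ) :
    HasLaw (fun ω ↦ ∑ k ∈ Finset.range n, (b (τ (k + 1)) ω - b (τ k) ω) * c k)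
      (gaussianReal 0 (∑ k ∈ Finset.range n, ‖c k‖₊ ^ 2 * (τ (k + 1) - τ k))) P := by
  have hlaw (k : ℕ) : HasLaw (fun ω ↦ (b (τ (k + 1)) ω - b (τ k) ω) * c k)
      (gaussianReal 0 (‖c k‖₊ ^ 2 * (τ (k + 1) - τ k))) P := by
    convert! gaussianReal_mul_const (hb.hasLaw_sub (τ (k + 1)) (τ k)) (c k) using 2
    · simp
    · ext
      simp [NNReal.coe_sub (hτ k.le_succ), Real.dist_eq,
        abs_of_nonneg (sub_nonneg.2 (NNReal.coe_le_coe.2 (hτ k.le_succ)))]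
  have hind : iIndepFun (fun k ω ↦ (b (τ (k + 1)) ω - b (τ k) ω) * c k) P :=
    (hb.hasIndepIncrements.nat hτ).comp (fun k y ↦ y * c k) fun k ↦ by fun_prop
  simpa using hasLaw_sum_gaussianReal hlaw hind (Finset.range n)

lemma IsStandardBrownian.hasLaw_sum_inner_increment {n : ℕ} {B : ℝ≥0 → Ω → EuclideanSpace ℝ (Fin n)}
    (hB : IsStandardBrownian B P) {τ : ℕ → ℝ≥0} (hτ : Monotone τ)
    (c : ℕ → EuclideanSpace ℝ (Fin n)) (N : ℕ) :
    HasLaw (fun ω ↦ ∑ k ∈ Finset.range N, inner ℝ (B (τ (k + 1)) ω - B (τ k) ω) (c k))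
      (gaussianReal 0 (∑ k ∈ Finset.range N, ‖c k‖₊ ^ 2 * (τ (k + 1) - τ k))) P := by
  have hlaw (i : Fin n) := hasLaw_sum_mul_brownian_increment (hB.coord i).toIsPreBrownianReal hτ
    (fun k ↦ c k i) N
  have hind : iIndepFun (fun i ω ↦ ∑ k ∈ Finset.range N,
      (B (τ (k + 1)) ω i - B (τ k) ω i) * c k i) P :=
    hB.indep.comp (fun i y ↦ ∑ k ∈ Finset.range N, (y (τ (k + 1)) - y (τ k)) * c k i)
      fun i ↦ by fun_prop
  convert! hasLaw_sum_gaussianReal hlaw hind Finset.univ using 2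
  · rw [Finset.sum_comm]
    simp [PiLp.inner_apply, mul_comm]
  · simp
  · ext
    push_cast
    simp_rw [Finset.sum_comm (s := Finset.univ), ← Finset.sum_mul, EuclideanSpace.real_norm_sq_eq,
      Real.norm_eq_abs, sq_abs]

end BrownianSums

section WienerIntegral

variable {Ω : Type*} [MeasurableSpace Ω] {P : Measure Ω}

lemma hasLaw_gaussianReal_of_tendsto_ae [IsProbabilityMeasure P] {Y : ℕ → Ω → ℝ} {Z : Ω → ℝ}
    {v : ℕ → ℝ≥0} {w : ℝ≥0} (hY : ∀ n, HasLaw (Y n) (gaussianReal 0 (v n)) P)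
    (hYZ : ∀ᵐ ω ∂P, Tendsto (fun n ↦ Y n ω) atTop (𝓝 (Z ω))) (hv : Tendsto v atTop (𝓝 w)) :
    HasLaw Z (gaussianReal 0 w) P := by
  have hZ : AEMeasurable Z P :=
    aemeasurable_of_tendsto_metrizable_ae atTop (fun n ↦ (hY n).aemeasurable) hYZ
  refine ⟨hZ, ?_⟩
  have := Measure.isProbabilityMeasure_map (μ := P) hZ
  refine Measure.ext_of_charFun (funext fun z ↦ ?_)
  have hlim : Tendsto (fun n ↦ charFun (P.map (Y n)) z) atTop (𝓝 (charFun (P.map Z) z)) := by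
    simp_rw [charFun_apply_real]
    rw [integral_map hZ (by fun_prop)]
    simp_rw [fun n ↦ integral_map (hY n).aemeasurable
      (f := fun y : ℝ ↦ Complex.exp (z * y * Complex.I)) (by fun_prop)]
    refine tendsto_integral_of_dominated_convergence (fun _ ↦ 1) (fun n ↦ ?_)
      (integrable_const _) (fun n ↦ ae_of_all _ fun ω ↦ ?_) ?_
    · have := (hY n).aemeasurable
      fun_prop
    · rw [← Complex.ofReal_mul, Complex.norm_exp_ofReal_mul_I]
    · filter_upwards [hYZ] with ω hω
      exact ((show Continuous fun y : ℝ ↦ Complex.exp (z * y * Complex.I) by fun_prop).tendsto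
        _).comp hω
  refine tendsto_nhds_unique hlim ?_
  simp_rw [(hY _).map_eq, charFun_gaussianReal]
  have hcont : Continuous fun r : ℝ≥0 ↦
      Complex.exp (z * (0 : ℝ) * Complex.I - (r : ℝ) * z ^ 2 / 2) := by fun_prop
  exact (hcont.tendsto w).comp hv

variable {n : ℕ} {B : ℝ≥0 → Ω → EuclideanSpace ℝ (Fin n)}

lemma IsStandardBrownian.ae_continuous (hB : IsStandardBrownian B P) :
    ∀ᵐ ω ∂P, Continuous fun t ↦ B t ω := by
  filter_upwards [ae_all_iff.2 fun i ↦ (hB.coord i).cont] with ω hω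
  exact (PiLp.continuous_toLp 2 _).comp (continuous_pi hω)

lemma IsStandardBrownian.ae_eq_zero (hB : IsStandardBrownian B P) : ∀ᵐ ω ∂P, B 0 ω = 0 := by
  filter_upwards [ae_all_iff.2 fun i ↦ (hB.coord i).toIsPreBrownianReal.eval_zero_ae_eq_zero]
    with ω hω
  ext i
  exact hω i

-- The random variable is `∫₀ᵗ ⟨g, dB⟩`, integrated by parts.
lemma IsStandardBrownian.hasLaw_wienerIntegral [IsProbabilityMeasure P]
    (hB : IsStandardBrownian B P) {g g' : ℝ → EuclideanSpace ℝ (Fin n)}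
    (hg : ∀ s, HasDerivAt g (g' s) s) (hg' : Continuous g') (t : ℝ≥0) :
    HasLaw (fun ω ↦ inner ℝ (B t ω) (g t) - ∫ s in (0 : ℝ)..t, inner ℝ (B s.toNNReal ω) (g' s))
      (gaussianReal 0 (∫ s in (0 : ℝ)..t, ‖g s‖ ^ 2).toNNReal) P := by
  have hgc : Continuous g := continuous_iff_continuousAt.2 fun s ↦ (hg s).continuousAt
  have hgrid (N k : ℕ) : ((t : ℝ) * k / N).toNNReal = t * k / N := by
    rw [← Real.toNNReal_coe (r := t * k / N)]
    push_cast
    rfl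
  have hmono (N : ℕ) : Monotone fun k : ℕ ↦ t * k / N := fun i j hij ↦ by
    dsimp only
    gcongr
  refine hasLaw_gaussianReal_of_tendsto_ae
    (fun N ↦ hB.hasLaw_sum_inner_increment (hmono N) (fun k ↦ g (t * k / N)) N) ?_ ?_
  · filter_upwards [hB.ae_continuous, hB.ae_eq_zero] with ω hc h0
    simpa only [Function.comp_apply, hgrid, Real.toNNReal_coe] using tendsto_sum_increment_inner
      (hc.comp continuous_real_toNNReal) (by simpa using h0) hg hg' t.coe_nonneg
  · rw [← NNReal.tendsto_coe, Real.coe_toNNReal _ (intervalIntegral.integral_nonneg t.coe_nonneg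
      fun s _ ↦ sq_nonneg _)]
    refine (tendsto_sum_mul_mesh (f := fun s ↦ ‖g s‖ ^ 2) (by fun_prop)
      t.coe_nonneg).congr fun N ↦ ?_
    rw [NNReal.coe_sum]
    refine Finset.sum_congr rfl fun k _ ↦ ?_
    rw [NNReal.coe_mul, NNReal.coe_sub (hmono N k.le_succ)]
    push_cast
    ring

end WienerIntegral

section DecayFlow

variable {E : Type*} [NormedAddCommGroup E] [InnerProductSpace ℝ E]

/-- The flow `e^{-tT}` of the linear equation `ẏ = -T y`. -/
noncomputable def decayFlow (T : E →L[ℝ] E) (t : ℝ) : E →L[ℝ] E := NormedSpace.exp (t • (-T))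

@[simp] lemma decayFlow_zero (T : E →L[ℝ] E) : decayFlow T 0 = 1 := by simp [decayFlow]

variable [CompleteSpace E]

lemma hasDerivAt_decayFlow_apply (T : E →L[ℝ] E) (y : E) (t : ℝ) :
    HasDerivAt (fun t ↦ decayFlow T t y) (-(T (decayFlow T t y))) t := by
  simpa [decayFlow] using
    (hasDerivAt_exp_smul_const' (𝕂 := ℝ) (-T) t).clm_apply (hasDerivAt_const t y)

lemma hasDerivAt_decayFlow_const_sub_apply (T : E →L[ℝ] E) (y : E) (t s : ℝ) :
    HasDerivAt (fun s ↦ decayFlow T (t - s) y) (T (decayFlow T (t - s) y)) s := by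
  simpa using (hasDerivAt_decayFlow_apply T y (t - s)).comp_const_sub t s

lemma continuous_decayFlow_apply (T : E →L[ℝ] E) (y : E) : Continuous fun t ↦ decayFlow T t y :=
  continuous_iff_continuousAt.2 fun t ↦ (hasDerivAt_decayFlow_apply T y t).continuousAt

lemma adjoint_decayFlow (T : E →L[ℝ] E) (t : ℝ) :
    (decayFlow T t).adjoint = decayFlow T.adjoint t := by
  simpa [decayFlow, ContinuousLinearMap.star_eq_adjoint] using NormedSpace.star_exp (t • (-T))

lemma decayFlow_apply_of_eigen {T : E →L[ℝ] E} {c : ℝ} {w : E} (hw : T w = c • w) (t : ℝ) :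
    decayFlow T t w = Real.exp (-(c * t)) • w := by
  have hd (s : ℝ) : HasDerivAt (fun s ↦ decayFlow T s (Real.exp (c * s) • w)) 0 s := by
    have hflow := hasDerivAt_exp_smul_const (𝕂 := ℝ) (-T) s
    have hexp := (((hasDerivAt_id s).const_mul c).exp).smul_const w
    refine (hflow.clm_apply hexp).congr_deriv ?_
    simp [hw, smul_smul, mul_comm]
  have hconst := is_const_of_deriv_eq_zero (fun s ↦ (hd s).differentiableAt)
    (fun s ↦ (hd s).deriv) t 0
  have hone : Real.exp (c * t) • decayFlow T t w = w := by simpa using hconst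
  rw [Real.exp_neg, eq_inv_smul_iff₀ (Real.exp_ne_zero _), hone]

lemma adjoint_decayFlow_comp_decayFlow {T : E →L[ℝ] E} (hT : Commute T T.adjoint) (t : ℝ) :
    (decayFlow T t).adjoint * decayFlow T t = decayFlow (T + T.adjoint) t := by
  let _ := NormedAlgebra.restrictScalars ℚ ℝ (E →L[ℝ] E)
  rw [adjoint_decayFlow, decayFlow, decayFlow, decayFlow, ← NormedSpace.exp_add_of_commute
    (hT.symm.neg_left.neg_right.smul_left t |>.smul_right t)]
  congr 1
  module

lemma norm_decayFlow_sq_eq_sum {ι : Type*} [Fintype ι] {T : E →L[ℝ] E}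
    (hT : Commute T T.adjoint) (w : OrthonormalBasis ι ℝ E) {s : ι → ℝ}
    (hw : ∀ k, (T + T.adjoint) (w k) = s k • w k) (t : ℝ) (y : E) :
    ‖decayFlow T t y‖ ^ 2 = ∑ k, Real.exp (-(s k * t)) * inner ℝ (w k) y ^ 2 := by
  have hflow : decayFlow (T + T.adjoint) t y =
      ∑ k, inner ℝ (w k) y • Real.exp (-(s k * t)) • w k := by
    conv_lhs => rw [← w.sum_repr' y]
    simp only [map_sum, map_smul, decayFlow_apply_of_eigen (hw _)]
  rw [← real_inner_self_eq_norm_sq, ← ContinuousLinearMap.adjoint_inner_right,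
    ← mul_apply_eq_comp, adjoint_decayFlow_comp_decayFlow hT, hflow, inner_sum]
  refine Finset.sum_congr rfl fun k _ ↦ ?_
  rw [inner_smul_right, inner_smul_right, real_inner_comm y]
  ring

lemma inner_eq_of_integral_equation (T : E →L[ℝ] E) (x u : E) {X b : ℝ → E} (hX : Continuous X)
    (hb : Continuous b) {t : ℝ} (ht : 0 ≤ t)
    (h : ∀ s ∈ Set.Icc 0 t, X s = x - (∫ r in (0 : ℝ)..s, T (X r)) + b s) :
    inner ℝ (X t) u = inner ℝ (decayFlow T t x) u + (inner ℝ (b t) u -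
      ∫ s in (0 : ℝ)..t, inner ℝ (b s) (T.adjoint (decayFlow T.adjoint (t - s) u))) := by
  set G : ℝ → E := fun s ↦ decayFlow T.adjoint (t - s) u
  set Y : ℝ → E := fun s ↦ x - ∫ r in (0 : ℝ)..s, T (X r)
  have hG (s : ℝ) : HasDerivAt G (T.adjoint (G s)) s :=
    hasDerivAt_decayFlow_const_sub_apply T.adjoint u t s
  have hGc : Continuous G := continuous_iff_continuousAt.2 fun s ↦ (hG s).continuousAt
  have hTX : Continuous fun r ↦ T (X r) := T.continuous.comp hX
  have hY (s : ℝ) : HasDerivAt Y (-T (X s)) s :=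
    (intervalIntegral.integral_hasDerivAt_right (hTX.intervalIntegrable _ _)
      hTX.aestronglyMeasurable.stronglyMeasurableAtFilter hTX.continuousAt).const_sub x
  have hXY : ∀ s ∈ Set.Icc 0 t, X s = Y s + b s := h
  have hderiv : ∀ s ∈ Set.uIcc 0 t,
      HasDerivAt (fun s ↦ inner ℝ (Y s) (G s)) (-inner ℝ (b s) (T.adjoint (G s))) s := by
    intro s hs
    refine ((hY s).inner ℝ (hG s)).congr_deriv ?_
    rw [hXY s (Set.uIcc_of_le ht ▸ hs), ContinuousLinearMap.adjoint_inner_right,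
      ContinuousLinearMap.adjoint_inner_right, map_add, inner_neg_left, inner_add_left]
    ring
  have hint := intervalIntegral.integral_eq_sub_of_hasDerivAt hderiv
    ((hb.inner (𝕜 := ℝ) (T.adjoint.continuous.comp hGc)).neg.intervalIntegrable _ _)
  have hGt : G t = u := by simp [G]
  have hYG0 : inner ℝ (Y 0) (G 0) = inner ℝ (decayFlow T t x) u := by
    simp [Y, G, ← adjoint_decayFlow, ContinuousLinearMap.adjoint_inner_right]
  rw [intervalIntegral.integral_neg, hGt, hYG0] at hint
  rw [hXY t ⟨ht, le_rfl⟩, inner_add_left]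
  linarith

end DecayFlow

lemma IsOUSolution.hasLaw_inner {Ω : Type*} [MeasurableSpace Ω] {P : Measure Ω}
    [IsProbabilityMeasure P] {m n : ℕ} {A : Matrix (Fin m) (Fin m) ℝ}
    {σ : Matrix (Fin m) (Fin n) ℝ} {B : ℝ≥0 → Ω → EuclideanSpace ℝ (Fin n)}
    {x : EuclideanSpace ℝ (Fin m)} {X : ℝ≥0 → Ω → EuclideanSpace ℝ (Fin m)}
    (hX : IsOUSolution A σ B P x X) (hB : IsStandardBrownian B P) (t : ℝ≥0)
    (u : EuclideanSpace ℝ (Fin m)) :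
    HasLaw (fun ω ↦ inner ℝ (X t ω) u)
      (gaussianReal (inner ℝ (decayFlow (Matrix.toEuclideanCLM (𝕜 := ℝ) A) t x) u)
        (∫ s in (0 : ℝ)..t, ‖σ.toEuclideanLin.toContinuousLinearMap.adjoint
          (decayFlow (Matrix.toEuclideanCLM (𝕜 := ℝ) A).adjoint s u)‖ ^ 2).toNNReal) P := by
  set T := Matrix.toEuclideanCLM (𝕜 := ℝ) A
  set S := σ.toEuclideanLin.toContinuousLinearMap
  have hderiv (s : ℝ) : HasDerivAt (fun s ↦ S.adjoint (decayFlow T.adjoint (t - s) u))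
      (S.adjoint (T.adjoint (decayFlow T.adjoint (t - s) u))) s :=
    S.adjoint.hasFDerivAt.comp_hasDerivAt s (hasDerivAt_decayFlow_const_sub_apply T.adjoint u t s)
  have hflow : Continuous fun s : ℝ ↦ decayFlow T.adjoint (t - s) u :=
    (continuous_decayFlow_apply T.adjoint u).comp (continuous_const.sub continuous_id)
  have hwiener := gaussianReal_const_add (hB.hasLaw_wienerIntegral hderiv (by fun_prop) t)
    (inner ℝ (decayFlow T t x) u)
  rw [intervalIntegral.integral_comp_sub_left
    (fun s ↦ ‖S.adjoint (decayFlow T.adjoint s u)‖ ^ 2), sub_self, sub_zero, zero_add] at hwiener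
  refine hwiener.congr ?_
  filter_upwards [hB.ae_continuous, hX.continuous, hX.equation] with ω hBc hXc hXe
  have hSB : Continuous fun s : ℝ ↦ S (B s.toNNReal ω) :=
    S.continuous.comp (hBc.comp continuous_real_toNNReal)
  have hvoc := inner_eq_of_integral_equation T x u (hXc.comp continuous_real_toNNReal) hSB
    t.coe_nonneg fun s hs ↦ by
      simpa only [Real.coe_toNNReal s hs.1] using! hXe s.toNNReal
  simpa only [Function.comp_apply, Real.toNNReal_coe, sub_self, decayFlow_zero,
    ContinuousLinearMap.adjoint_inner_right, one_apply_eq_self] using hvoc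

section Moments

variable {Ω : Type*} [MeasurableSpace Ω] {P : Measure Ω} [IsProbabilityMeasure P] {f g : Ω → ℝ}

lemma covariance_le_sqrt_variance_mul_sqrt_variance (hf : MemLp f 2 P) (hg : MemLp g 2 P) :
    cov[f, g; P] ≤ √(Var[f; P]) * √(Var[g; P]) := by
  have hquad (r : ℝ) : 0 ≤ Var[g; P] * (r * r) + 2 * cov[f, g; P] * r + Var[f; P] := by
    have := variance_nonneg (fun ω ↦ f ω + r * g ω) P
    rw [variance_fun_add hf (hg.const_mul r), covariance_const_mul_right, variance_const_mul]
      at this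
    linarith
  have hdiscrim := discrim_le_zero hquad
  rw [discrim] at hdiscrim
  rw [← Real.sqrt_mul (variance_nonneg f P)]
  exact Real.le_sqrt_of_sq_le (by linarith)

lemma sq_integral_add_variance_eq_integral_sq (hf : MemLp f 2 P) :
    (∫ ω, f ω ∂P) ^ 2 + Var[f; P] = ∫ ω, f ω ^ 2 ∂P := by
  rw [variance_eq_sub hf, add_sub_cancel]
  rfl

lemma sq_integral_sub_add_sq_sqrt_variance_sub_le (hf : MemLp f 2 P) (hg : MemLp g 2 P) :
    ((∫ ω, f ω ∂P) - ∫ ω, g ω ∂P) ^ 2 + (√(Var[f; P]) - √(Var[g; P])) ^ 2 ≤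
      ∫ ω, (f ω - g ω) ^ 2 ∂P := by
  have hsub : MemLp (fun ω ↦ f ω - g ω) 2 P := hf.sub hg
  rw [← sq_integral_add_variance_eq_integral_sq hsub, variance_fun_sub hf hg,
    integral_sub (hf.integrable one_le_two) (hg.integrable one_le_two), sub_sq (√_),
    Real.sq_sqrt (variance_nonneg _ _), Real.sq_sqrt (variance_nonneg _ _)]
  linarith [covariance_le_sqrt_variance_mul_sqrt_variance hf hg]

end Moments

section Wasserstein

variable {E : Type*}

lemma wasserstein_two_eq [PseudoEMetricSpace E] [MeasurableSpace E] (μ₁ μ₂ : Measure E) :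
    wasserstein 2 μ₁ μ₂ =
      (⨅ γ ∈ couplings μ₁ μ₂, ∫⁻ z, edist z.1 z.2 ^ (2 : ℝ) ∂γ) ^ (1 / 2 : ℝ) := by
  rw [wasserstein, min_eq_right (by norm_num)]

lemma ofReal_rpow_one_half {c : ℝ} (hc : 0 ≤ c) :
    ENNReal.ofReal c ^ (1 / 2 : ℝ) = ENNReal.ofReal √c := by
  rw [ENNReal.ofReal_rpow_of_nonneg hc (by norm_num), Real.sqrt_eq_rpow]

variable [NormedAddCommGroup E] [InnerProductSpace ℝ E] {ι : Type*} [Fintype ι]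
  (w : OrthonormalBasis ι ℝ E)

lemma edist_rpow_two_eq_sum (x y : E) :
    edist x y ^ (2 : ℝ) = ∑ k, ENNReal.ofReal ((inner ℝ x (w k) - inner ℝ y (w k)) ^ 2) := by
  rw [edist_dist, dist_eq_norm, ENNReal.ofReal_rpow_of_nonneg (norm_nonneg _) zero_le_two,
    Real.rpow_two, ← w.sum_sq_inner_left, ENNReal.ofReal_sum_of_nonneg fun _ _ ↦ sq_nonneg _]
  simp_rw [inner_sub_left]

variable [MeasurableSpace E] {μ₁ μ₂ : Measure E}

lemma lintegral_edist_rpow_two_of_mem_couplings {γ : Measure (E × E)} (hγ : γ ∈ couplings μ₁ μ₂)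
    (h₁ : ∀ k, MemLp (fun x ↦ inner ℝ x (w k)) 2 μ₁)
    (h₂ : ∀ k, MemLp (fun x ↦ inner ℝ x (w k)) 2 μ₂) :
    ∫⁻ z, edist z.1 z.2 ^ (2 : ℝ) ∂γ =
      ENNReal.ofReal (∑ k, ∫ z, (inner ℝ z.1 (w k) - inner ℝ z.2 (w k)) ^ 2 ∂γ) := by
  have hint (k : ι) : Integrable (fun z : E × E ↦ (inner ℝ z.1 (w k) - inner ℝ z.2 (w k)) ^ 2) γ :=
    (((h₁ k).comp_measurePreserving ⟨measurable_fst, hγ.1⟩).sub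
      ((h₂ k).comp_measurePreserving ⟨measurable_snd, hγ.2⟩)).integrable_sq
  simp_rw [edist_rpow_two_eq_sum w]
  rw [lintegral_finsetSum' _ fun k _ ↦ (hint k).aestronglyMeasurable.aemeasurable.ennreal_ofReal,
    ENNReal.ofReal_sum_of_nonneg fun k _ ↦ integral_nonneg fun _ ↦ sq_nonneg _]
  exact Finset.sum_congr rfl fun k _ ↦
    (ofReal_integral_eq_lintegral_ofReal (hint k) (ae_of_all _ fun _ ↦ sq_nonneg _)).symm

lemma wasserstein_two_le_of_mem_couplings {γ : Measure (E × E)} (hγ : γ ∈ couplings μ₁ μ₂)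
    (h₁ : ∀ k, MemLp (fun x ↦ inner ℝ x (w k)) 2 μ₁)
    (h₂ : ∀ k, MemLp (fun x ↦ inner ℝ x (w k)) 2 μ₂) :
    wasserstein 2 μ₁ μ₂ ≤
      ENNReal.ofReal √(∑ k, ∫ z, (inner ℝ z.1 (w k) - inner ℝ z.2 (w k)) ^ 2 ∂γ) := by
  rw [wasserstein_two_eq, ← ofReal_rpow_one_half
    (Finset.sum_nonneg fun k _ ↦ integral_nonneg fun _ ↦ sq_nonneg _)]
  gcongr
  exact iInf₂_le_of_le γ hγ (lintegral_edist_rpow_two_of_mem_couplings w hγ h₁ h₂).le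

lemma le_wasserstein_two [IsProbabilityMeasure μ₁]
    (h₁ : ∀ k, MemLp (fun x ↦ inner ℝ x (w k)) 2 μ₁)
    (h₂ : ∀ k, MemLp (fun x ↦ inner ℝ x (w k)) 2 μ₂) :
    ENNReal.ofReal √(∑ k, (((∫ x, inner ℝ x (w k) ∂μ₁) - ∫ x, inner ℝ x (w k) ∂μ₂) ^ 2 +
      (√(Var[fun x ↦ inner ℝ x (w k); μ₁]) - √(Var[fun x ↦ inner ℝ x (w k); μ₂])) ^ 2)) ≤
      wasserstein 2 μ₁ μ₂ := by
  rw [wasserstein_two_eq, ← ofReal_rpow_one_half (Finset.sum_nonneg fun k _ ↦ by positivity)]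
  gcongr
  refine le_iInf₂ fun γ hγ ↦ ?_
  rw [lintegral_edist_rpow_two_of_mem_couplings w hγ h₁ h₂]
  refine ENNReal.ofReal_le_ofReal (Finset.sum_le_sum fun k _ ↦ ?_)
  have hfst : MeasurePreserving Prod.fst γ μ₁ := ⟨measurable_fst, hγ.1⟩
  have hsnd : MeasurePreserving Prod.snd γ μ₂ := ⟨measurable_snd, hγ.2⟩
  have : IsProbabilityMeasure γ := hfst.hasLaw.isProbabilityMeasure
  rw [← hfst.hasLaw.integral_comp (h₁ k).1, ← hsnd.hasLaw.integral_comp (h₂ k).1,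
    ← hfst.variance_fun_comp (h₁ k).1.aemeasurable, ← hsnd.variance_fun_comp (h₂ k).1.aemeasurable]
  exact sq_integral_sub_add_sq_sqrt_variance_sub_le
    ((h₁ k).comp_measurePreserving hfst) ((h₂ k).comp_measurePreserving hsnd)

end Wasserstein

section DiagGaussian

variable {E : Type*} [NormedAddCommGroup E] [InnerProductSpace ℝ E] {ι : Type*} [Fintype ι]

/-- The affine map `ℝ^ι → E` sending the `k`-th standard coordinate axis to `σ k` times the `k`-th
vector of the orthonormal basis `w`, and `0` to `a`. -/
noncomputable def diagAffine (w : OrthonormalBasis ι ℝ E) (a : E) (σ z : ι → ℝ) : E :=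
  a + ∑ k, (σ k * z k) • w k

/-- The Gaussian law on `E` with mean `a` whose covariance is diagonal in the orthonormal basis `w`,
with standard deviations `σ`, constructed as an affine image of a standard Gaussian vector. A
standard deviation enters through its absolute value only. -/
noncomputable def diagGaussian [MeasurableSpace E] (w : OrthonormalBasis ι ℝ E) (a : E)
    (σ : ι → ℝ) : Measure E :=
  (Measure.pi fun _ : ι ↦ gaussianReal 0 1).map (diagAffine w a σ)

variable (w : OrthonormalBasis ι ℝ E) (a b : E) (σ τ : ι → ℝ)

lemma inner_diagAffine (z : ι → ℝ) (u : E) :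
    inner ℝ (diagAffine w a σ z) u = inner ℝ a u + ∑ k, σ k * inner ℝ (w k) u * z k := by
  simp only [diagAffine, inner_add_left, sum_inner, real_inner_smul_left, mul_right_comm]

lemma inner_diagAffine_basis (z : ι → ℝ) (k : ι) :
    inner ℝ (diagAffine w a σ z) (w k) = inner ℝ a (w k) + σ k * z k := by
  classical
  simp [inner_diagAffine, w.inner_eq_ite]

lemma continuous_diagAffine : Continuous (diagAffine w a σ) := by
  unfold diagAffine
  fun_prop

variable [MeasurableSpace E] [BorelSpace E]

lemma measurable_diagAffine : Measurable (diagAffine w a σ) :=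
  (continuous_diagAffine w a σ).measurable

instance : IsProbabilityMeasure (diagGaussian w a σ) :=
  Measure.isProbabilityMeasure_map (measurable_diagAffine w a σ).aemeasurable

lemma hasLaw_inner_diagGaussian (u : E) :
    HasLaw (fun x ↦ inner ℝ x u)
      (gaussianReal (inner ℝ a u) (∑ k, (σ k * inner ℝ (w k) u) ^ 2).toNNReal)
      (diagGaussian w a σ) where
  aemeasurable := by fun_prop
  map_eq := by
    have hcoord (k : ι) : HasLaw (fun z : ι → ℝ ↦ σ k * inner ℝ (w k) u * z k)
        (gaussianReal 0 (‖σ k * inner ℝ (w k) u‖₊ ^ 2)) (Measure.pi fun _ ↦ gaussianReal 0 1) := by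
      convert! gaussianReal_const_mul
        (measurePreserving_eval (fun _ : ι ↦ gaussianReal 0 1) k).hasLaw _ using 2
      · simp
      · ext
        simp [mul_pow]
    have hind := iIndepFun_pi (μ := fun _ : ι ↦ gaussianReal 0 1)
      (X := fun k z ↦ σ k * inner ℝ (w k) u * z) fun k ↦ by fun_prop
    have hsum := gaussianReal_const_add
      (hasLaw_sum_gaussianReal hcoord hind Finset.univ) (inner ℝ a u)
    rw [diagGaussian, Measure.map_map (by fun_prop) (measurable_diagAffine w a σ)]
    convert! hsum.map_eq using 2
    · ext z
      simp [inner_diagAffine]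
    · simp
    · ext
      rw [Real.coe_toNNReal _ (Finset.sum_nonneg fun _ _ ↦ sq_nonneg _)]
      simp [mul_pow]

lemma hasLaw_inner_basis_diagGaussian (k : ι) :
    HasLaw (fun x ↦ inner ℝ x (w k)) (gaussianReal (inner ℝ a (w k)) (σ k ^ 2).toNNReal)
      (diagGaussian w a σ) := by
  classical
  simpa [w.inner_eq_ite] using hasLaw_inner_diagGaussian w a σ (w k)

lemma memLp_inner_basis_diagGaussian (k : ι) :
    MemLp (fun x ↦ inner ℝ x (w k)) 2 (diagGaussian w a σ) :=
  (hasLaw_inner_basis_diagGaussian w a σ k).hasGaussianLaw.memLp_two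

lemma integral_inner_basis_diagGaussian (k : ι) :
    ∫ x, inner ℝ x (w k) ∂diagGaussian w a σ = inner ℝ a (w k) := by
  rw [(hasLaw_inner_basis_diagGaussian w a σ k).integral_eq, integral_id_gaussianReal]

lemma variance_inner_basis_diagGaussian (k : ι) :
    Var[fun x ↦ inner ℝ x (w k); diagGaussian w a σ] = σ k ^ 2 := by
  rw [(hasLaw_inner_basis_diagGaussian w a σ k).variance_eq, variance_id_gaussianReal,
    Real.coe_toNNReal _ (sq_nonneg _)]

lemma integral_add_const_mul_sq_gaussianReal (c d : ℝ) :
    ∫ z, (c + d * z) ^ 2 ∂gaussianReal 0 1 = c ^ 2 + d ^ 2 := by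
  have hlaw := gaussianReal_const_add
    (gaussianReal_const_mul (HasLaw.id (μ := gaussianReal 0 1)) d) c
  have := sq_integral_add_variance_eq_integral_sq hlaw.hasGaussianLaw.memLp_two
  rw [hlaw.integral_eq, hlaw.variance_eq, integral_id_gaussianReal, variance_id_gaussianReal]
    at this
  simpa [add_comm] using this.symm

lemma wasserstein_two_diagGaussian_le [SecondCountableTopology E] :
    wasserstein 2 (diagGaussian w a σ) (diagGaussian w b τ) ≤
      ENNReal.ofReal √(∑ k, ((inner ℝ a (w k) - inner ℝ b (w k)) ^ 2 + (σ k - τ k) ^ 2)) := by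
  have hφ := measurable_diagAffine w a σ
  have hψ := measurable_diagAffine w b τ
  -- The two Gaussian vectors are driven by the same standard Gaussian vector.
  have hcoupling : (Measure.pi fun _ : ι ↦ gaussianReal 0 1).map
      (fun z ↦ (diagAffine w a σ z, diagAffine w b τ z)) ∈
        couplings (diagGaussian w a σ) (diagGaussian w b τ) :=
    ⟨Measure.map_map measurable_fst (hφ.prodMk hψ), Measure.map_map measurable_snd (hφ.prodMk hψ)⟩
  refine (wasserstein_two_le_of_mem_couplings w hcoupling (memLp_inner_basis_diagGaussian w a σ)
    (memLp_inner_basis_diagGaussian w b τ)).trans_eq ?_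
  congr! with k
  rw [integral_map (hφ.prodMk hψ).aemeasurable (by fun_prop)]
  simp_rw [inner_diagAffine_basis, add_sub_add_comm, ← sub_mul]
  rw [← integral_add_const_mul_sq_gaussianReal]
  exact (measurePreserving_eval (fun _ : ι ↦ gaussianReal 0 1) k).hasLaw.integral_comp
    (f := fun z ↦ (inner ℝ a (w k) - inner ℝ b (w k) + (σ k - τ k) * z) ^ 2) (by fun_prop)

lemma wasserstein_two_diagGaussian [SecondCountableTopology E] {σ τ : ι → ℝ} (hσ : ∀ k, 0 ≤ σ k)
    (hτ : ∀ k, 0 ≤ τ k) :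
    wasserstein 2 (diagGaussian w a σ) (diagGaussian w b τ) =
      ENNReal.ofReal √(∑ k, ((inner ℝ a (w k) - inner ℝ b (w k)) ^ 2 + (σ k - τ k) ^ 2)) := by
  refine (wasserstein_two_diagGaussian_le w a b σ τ).antisymm ?_
  have := le_wasserstein_two w (memLp_inner_basis_diagGaussian w a σ)
    (memLp_inner_basis_diagGaussian w b τ)
  simpa only [integral_inner_basis_diagGaussian, variance_inner_basis_diagGaussian,
    Real.sqrt_sq (hσ _), Real.sqrt_sq (hτ _)] using this

lemma tendsto_lintegral_diagGaussian {α : Type*} {l : Filter α} [l.IsCountablyGenerated]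
    {a' : α → E} {σ' : α → ι → ℝ} (ha : Tendsto a' l (𝓝 a))
    (hσ : ∀ k, Tendsto (σ' · k) l (𝓝 (σ k))) (f : BoundedContinuousFunction E ℝ≥0) :
    Tendsto (fun i ↦ ∫⁻ x, f x ∂diagGaussian w (a' i) (σ' i)) l
      (𝓝 (∫⁻ x, f x ∂diagGaussian w a σ)) := by
  have hf : Measurable fun x ↦ (f x : ℝ≥0∞) := f.continuous.measurable.coe_nnreal_ennreal
  simp_rw [diagGaussian, lintegral_map hf (measurable_diagAffine _ _ _)]
  refine tendsto_lintegral_filter_of_dominated_convergence (fun _ ↦ (nndist f 0 : ℝ≥0∞))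
    (Eventually.of_forall fun i ↦ hf.comp (measurable_diagAffine _ _ _))
    (Eventually.of_forall fun i ↦ ae_of_all _ fun z ↦ ?_) (by simp) (ae_of_all _ fun z ↦ ?_)
  · exact_mod_cast BoundedContinuousFunction.NNReal.upper_bound f _
  · refine ENNReal.tendsto_coe.2 ((f.continuous.tendsto _).comp (ha.add ?_))
    exact tendsto_finsetSum _ fun k _ ↦ ((hσ k).mul_const _).smul_const _

end DiagGaussian

section StationaryLaw

lemma eq_of_forall_map_inner_eq {E : Type*} [NormedAddCommGroup E] [InnerProductSpace ℝ E]
    [CompleteSpace E] [SecondCountableTopology E] [MeasurableSpace E] [BorelSpace E]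
    {μ ν : Measure E} [IsFiniteMeasure μ] [IsFiniteMeasure ν]
    (h : ∀ u, μ.map (fun x ↦ inner ℝ x u) = ν.map (fun x ↦ inner ℝ x u)) : μ = ν := by
  refine Measure.ext_of_charFun (funext fun u ↦ ?_)
  have hdual : ⇑(InnerProductSpace.toDualMap ℝ E u) = fun x ↦ inner ℝ x u :=
    funext fun x ↦ real_inner_comm _ _
  rw [charFun_eq_charFunDual_toDualMap, charFun_eq_charFunDual_toDualMap,
    charFunDual_eq_charFun_map_one, charFunDual_eq_charFun_map_one, hdual, h]

lemma aemeasurable_of_bind_ne_zero {α β : Type*} [MeasurableSpace α] [MeasurableSpace β]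
    {μ : Measure α} {κ : α → Measure β} (h : μ.bind κ ≠ 0) : AEMeasurable κ μ := by
  contrapose! h
  rw [Measure.bind, Measure.map_of_not_aemeasurable h, Measure.join_zero]

lemma eq_of_bind_eq_of_tendsto_lintegral {E α : Type*} [TopologicalSpace E] [MeasurableSpace E]
    [BorelSpace E] [HasOuterApproxClosed E] {l : Filter α} [l.IsCountablyGenerated] [l.NeBot]
    {μ ν : Measure E} [IsProbabilityMeasure μ] {κ : α → E → Measure E}
    [∀ i y, IsProbabilityMeasure (κ i y)] (hμ : ∀ i, μ.bind (κ i) = μ)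
    (hκ : ∀ y (f : BoundedContinuousFunction E ℝ≥0),
      Tendsto (fun i ↦ ∫⁻ x, f x ∂κ i y) l (𝓝 (∫⁻ x, f x ∂ν))) :
    μ = ν := by
  refine ext_of_forall_lintegral_eq_of_IsFiniteMeasure fun f ↦ ?_
  have hf : Measurable fun x ↦ (f x : ℝ≥0∞) := f.continuous.measurable.coe_nnreal_ennreal
  have hmeas (i : α) : AEMeasurable (κ i) μ :=
    aemeasurable_of_bind_ne_zero (by rw [hμ i]; exact IsProbabilityMeasure.ne_zero μ)
  have hiter (i : α) : ∫⁻ x, f x ∂μ = ∫⁻ y, ∫⁻ x, f x ∂κ i y ∂μ := by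
    rw [← Measure.lintegral_bind (hmeas i) hf.aemeasurable, hμ]
  have hbound (i : α) (y : E) : ∫⁻ x, f x ∂κ i y ≤ nndist f 0 := by
    refine (lintegral_mono fun x ↦ ENNReal.coe_le_coe.2
      (BoundedContinuousFunction.NNReal.upper_bound f x)).trans_eq ?_
    simp
  have hlim : Tendsto (fun i ↦ ∫⁻ y, ∫⁻ x, f x ∂κ i y ∂μ) l (𝓝 (∫⁻ _, ∫⁻ x, f x ∂ν ∂μ)) :=
    tendsto_lintegral_filter_of_dominated_convergence' _
      (Eventually.of_forall fun i ↦ (Measure.measurable_lintegral hf).comp_aemeasurable (hmeas i))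
      (Eventually.of_forall fun i ↦ ae_of_all _ (hbound i)) (by simp) (ae_of_all _ fun y ↦ hκ y f)
  simp_rw [← hiter] at hlim
  simpa using tendsto_nhds_unique tendsto_const_nhds hlim

end StationaryLaw

section DecayRates

lemma integral_exp_neg_mul {c : ℝ} (hc : c ≠ 0) (t : ℝ) :
    ∫ r in (0 : ℝ)..t, Real.exp (-(c * r)) = (1 - Real.exp (-(c * t))) / c := by
  simp_rw [← neg_mul]
  rw [intervalIntegral.integral_comp_mul_left _ (neg_ne_zero.2 hc), integral_exp, smul_eq_mul,
    mul_zero, Real.exp_zero]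
  field_simp
  ring

lemma tendsto_exp_neg_mul_atTop {c : ℝ} (hc : 0 < c) :
    Tendsto (fun t : ℝ ↦ Real.exp (-(c * t))) atTop (𝓝 0) :=
  Real.tendsto_exp_neg_atTop_nhds_zero.comp (tendsto_id.const_mul_atTop hc)

variable {E : Type*} [NormedAddCommGroup E] [InnerProductSpace ℝ E] [CompleteSpace E]
  {ι : Type*} [Fintype ι] {T : E →L[ℝ] E} (hT : Commute T T.adjoint) (w : OrthonormalBasis ι ℝ E)
  {s : ι → ℝ} (hw : ∀ k, (T + T.adjoint) (w k) = s k • w k)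
include hT hw

lemma integral_norm_decayFlow_sq (hs : ∀ k, s k ≠ 0) (t : ℝ) (y : E) :
    ∫ r in (0 : ℝ)..t, ‖decayFlow T r y‖ ^ 2 =
      ∑ k, (1 - Real.exp (-(s k * t))) / s k * inner ℝ (w k) y ^ 2 := by
  simp_rw [norm_decayFlow_sq_eq_sum hT w hw]
  rw [intervalIntegral.integral_finsetSum fun k _ ↦ Continuous.intervalIntegrable (by fun_prop) _ _]
  exact Finset.sum_congr rfl fun k _ ↦ by
    rw [intervalIntegral.integral_mul_const, integral_exp_neg_mul (hs k)]

lemma tendsto_decayFlow_apply_atTop (hs : ∀ k, 0 < s k) (y : E) :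
    Tendsto (fun t ↦ decayFlow T t y) atTop (𝓝 0) := by
  have hsq : Tendsto (fun t ↦ ‖decayFlow T t y‖ ^ 2) atTop (𝓝 0) := by
    simp_rw [norm_decayFlow_sq_eq_sum hT w hw]
    simpa using tendsto_finsetSum (Finset.univ : Finset ι)
      fun k _ ↦ (tendsto_exp_neg_mul_atTop (hs k)).mul_const (inner ℝ (w k) y ^ 2)
  exact tendsto_zero_iff_norm_tendsto_zero.2 (by simpa using hsq.sqrt)

end DecayRates

/-- The rates at which an Ornstein-Uhlenbeck process approaches equilibrium, in terms of the decay
rates `ρ` of the eigenmodes of its drift: the mean relaxes along the mode `k` at rate `ρ k`, the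
standard deviation at rate `2 * ρ k`. The set `J` consists of the modes which are present in the
initial value. -/
def cutoffRates {ι : Type*} (ρ : ι → ℝ) (J : Set ι) : Set ℝ :=
  Set.range (fun k ↦ 2 * ρ k) ∪ ρ '' J

/-- The squared Wasserstein distance of order 2 between an Ornstein-Uhlenbeck process at time `t`
and its equilibrium, for a symmetrised drift with eigenvalues `s` and an initial value with
coordinates `a` in the eigenbasis. -/
noncomputable def sqDistToEquilibrium {ι : Type*} [Fintype ι] (s a : ι → ℝ) (t : ℝ) : ℝ :=
  ∑ k, (Real.exp (-(s k * t)) * a k ^ 2 + (1 - √(1 - Real.exp (-(s k * t)))) ^ 2 / s k)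

section CutoffRates

variable {ι : Type*} {ρ : ι → ℝ} {J : Set ι}

lemma isLeast_cutoffRates {r : ℝ} (hr : IsLeast (ρ '' J) r) (hle : ∀ k, r ≤ 2 * ρ k) :
    IsLeast (cutoffRates ρ J) r := by
  refine ⟨Or.inr hr.1, ?_⟩
  rintro _ (⟨k, rfl⟩ | hq)
  · exact hle k
  · exact hr.2 hq

lemma isLeast_cutoffRates_of_mem {i : ι} (hi : i ∈ J) (hle : ∀ k, ρ i ≤ ρ k) (h₀ : 0 ≤ ρ i) :
    IsLeast (cutoffRates ρ J) (ρ i) :=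
  isLeast_cutoffRates ⟨⟨i, hi, rfl⟩, by rintro _ ⟨k, -, rfl⟩; exact hle k⟩
    fun k ↦ by linarith [hle k]

lemma isLeast_cutoffRates_empty {i : ι} (hle : ∀ k, ρ i ≤ ρ k) :
    IsLeast (cutoffRates ρ ∅) (2 * ρ i) := by
  refine ⟨Or.inl ⟨i, rfl⟩, ?_⟩
  rintro _ (⟨k, rfl⟩ | ⟨k, ⟨⟩, -⟩)
  exact mul_le_mul_of_nonneg_left (hle k) zero_le_two

end CutoffRates

section SqDistToEquilibrium

variable {ι : Type*} [Fintype ι] {s a : ι → ℝ} {r t : ℝ}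

lemma one_sub_sqrt_one_sub_le {q : ℝ} (h₀ : 0 ≤ q) (h₁ : q ≤ 1) : 1 - √(1 - q) ≤ q := by
  have : 1 - q ≤ √(1 - q) := Real.le_sqrt_of_sq_le (by nlinarith)
  linarith

lemma half_le_one_sub_sqrt_one_sub {q : ℝ} (h : q ≤ 1) : q / 2 ≤ 1 - √(1 - q) := by
  have := Real.sqrt_one_add_le (x := -q) (by linarith)
  rw [← sub_eq_add_neg] at this
  linarith

lemma exp_neg_mul_eq_sq (s t : ℝ) : Real.exp (-(s * t)) = Real.exp (-(s / 2 * t)) ^ 2 := by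
  rw [← Real.exp_nat_mul]
  congr 1
  push_cast
  ring

lemma exp_neg_mul_le_one {c : ℝ} (hc : 0 ≤ c) (ht : 0 ≤ t) : Real.exp (-(c * t)) ≤ 1 :=
  Real.exp_le_one_iff.2 (neg_nonpos.2 (mul_nonneg hc ht))

variable (hs : ∀ k, 0 < s k)
include hs

lemma sqDistToEquilibrium_le
    (hr : r ∈ lowerBounds (cutoffRates (fun k ↦ s k / 2) {k | a k ≠ 0})) (ht : 0 ≤ t) :
    sqDistToEquilibrium s a t ≤ (∑ k, (a k ^ 2 + 1 / s k)) * Real.exp (-(r * t)) ^ 2 := by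
  rw [sqDistToEquilibrium, Finset.sum_mul]
  refine Finset.sum_le_sum fun k _ ↦ ?_
  have hmean : Real.exp (-(s k * t)) * a k ^ 2 ≤ a k ^ 2 * Real.exp (-(r * t)) ^ 2 := by
    obtain hk | hk := eq_or_ne (a k) 0
    · simp [hk]
    · have : r ≤ s k / 2 := hr (Or.inr ⟨k, hk, rfl⟩)
      rw [mul_comm, exp_neg_mul_eq_sq]
      gcongr
  have hdev : (1 - √(1 - Real.exp (-(s k * t)))) ^ 2 / s k ≤ 1 / s k * Real.exp (-(r * t)) ^ 2 := by
    have hq := exp_neg_mul_le_one (hs k).le ht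
    have hrk : r ≤ s k := hr (Or.inl ⟨k, mul_div_cancel₀ _ two_ne_zero⟩)
    rw [one_div_mul_eq_div]
    refine div_le_div_of_nonneg_right (pow_le_pow_left₀ ?_ ?_ 2) (hs k).le
    · exact (by positivity : 0 ≤ Real.exp (-(s k * t)) / 2).trans (half_le_one_sub_sqrt_one_sub hq)
    · exact (one_sub_sqrt_one_sub_le (Real.exp_pos _).le hq).trans (by gcongr)
  rw [add_mul]
  exact add_le_add hmean hdev

lemma exists_le_sqDistToEquilibrium (hr : r ∈ cutoffRates (fun k ↦ s k / 2) {k | a k ≠ 0}) :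
    ∃ c > 0, ∀ t, 0 ≤ t → c * Real.exp (-(r * t)) ^ 2 ≤ sqDistToEquilibrium s a t := by
  have hterm (k : ι) (t : ℝ) : Real.exp (-(s k * t)) * a k ^ 2 +
      (1 - √(1 - Real.exp (-(s k * t)))) ^ 2 / s k ≤ sqDistToEquilibrium s a t :=
    Finset.single_le_sum (f := fun k ↦ Real.exp (-(s k * t)) * a k ^ 2 +
      (1 - √(1 - Real.exp (-(s k * t)))) ^ 2 / s k)
      (fun k _ ↦ add_nonneg (by positivity) (div_nonneg (sq_nonneg _) (hs k).le))
      (Finset.mem_univ k)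
  obtain ⟨k, rfl⟩ | ⟨k, hk, rfl⟩ := hr
  · simp only [mul_div_cancel₀ (s k) two_ne_zero]
    refine ⟨1 / (4 * s k), one_div_pos.2 (mul_pos four_pos (hs k)), fun t ht ↦ ?_⟩
    have hhalf := half_le_one_sub_sqrt_one_sub (exp_neg_mul_le_one (hs k).le ht)
    calc 1 / (4 * s k) * Real.exp (-(s k * t)) ^ 2 = (Real.exp (-(s k * t)) / 2) ^ 2 / s k := by
          ring
      _ ≤ (1 - √(1 - Real.exp (-(s k * t)))) ^ 2 / s k :=
          div_le_div_of_nonneg_right (pow_le_pow_left₀ (by positivity) hhalf 2) (hs k).le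
      _ ≤ _ := (le_add_of_nonneg_left (by positivity)).trans (hterm k t)
  · refine ⟨a k ^ 2, sq_pos_of_ne_zero hk, fun t _ ↦ ?_⟩
    rw [← exp_neg_mul_eq_sq, mul_comm]
    exact (le_add_of_nonneg_right (div_nonneg (sq_nonneg _) (hs k).le)).trans (hterm k t)

end SqDistToEquilibrium

lemma exp_neg_mul_abs_log_div_eventuallyEq {r δ : ℝ} (hr : 0 < r) (hδ : 0 < δ) :
    (fun ε ↦ Real.exp (-(r * (δ * (1 / r * |Real.log ε|)).toNNReal)) / ε) =ᶠ[𝓝[>] 0]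
      fun ε ↦ ε ^ (δ - 1) := by
  filter_upwards [Ioo_mem_nhdsGT one_pos] with ε hε
  rw [Real.coe_toNNReal _ (by positivity), abs_of_neg (Real.log_neg hε.1 hε.2),
    Real.rpow_sub_one hε.1.ne', Real.rpow_def_of_pos hε.1]
  congr 2
  field_simp

lemma cutoffStability_of_exp_bounds {d : ℝ≥0 → ℝ} {r c C : ℝ} (hr : 0 < r) (hc : 0 < c)
    (hlow : ∀ t : ℝ≥0, c * Real.exp (-(r * t)) ≤ d t)
    (hupp : ∀ t : ℝ≥0, d t ≤ C * Real.exp (-(r * t))) :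
    CutoffStability d (fun ε ↦ 1 / r * |Real.log ε|) := by
  refine ⟨fun δ hδ hδ₁ ↦ ?_, fun δ hδ₁ ↦ ?_⟩
  · have hlim : Tendsto (fun ε : ℝ ↦ c * ε ^ (δ - 1)) (𝓝[>] 0) atTop :=
      (tendsto_rpow_neg_nhdsGT_zero (by linarith)).const_mul_atTop hc
    refine tendsto_atTop_mono' _ ?_ hlim
    filter_upwards [exp_neg_mul_abs_log_div_eventuallyEq hr hδ, self_mem_nhdsWithin] with ε h hε
    rw [← h, ← mul_div_assoc]
    exact div_le_div_of_nonneg_right (hlow _) (le_of_lt hε)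
  · have hδ : 0 < δ := one_pos.trans hδ₁
    have hlim : Tendsto (fun ε : ℝ ↦ C * ε ^ (δ - 1)) (𝓝[>] 0) (𝓝 0) := by
      have := Real.continuousAt_rpow_const 0 (δ - 1) (Or.inr (sub_nonneg.2 hδ₁.le))
      simpa [Real.zero_rpow (sub_pos.2 hδ₁).ne'] using
        (this.tendsto.mono_left (nhdsWithin_le_nhds (s := Set.Ioi 0))).const_mul C
    refine tendsto_of_tendsto_of_tendsto_of_le_of_le' tendsto_const_nhds hlim ?_ ?_
    · filter_upwards [self_mem_nhdsWithin] with ε hε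
      exact div_nonneg ((by positivity : 0 ≤ c * _).trans (hlow _)) (le_of_lt hε)
    · filter_upwards [exp_neg_mul_abs_log_div_eventuallyEq hr hδ, self_mem_nhdsWithin] with ε h hε
      rw [← h, ← mul_div_assoc]
      exact div_le_div_of_nonneg_right (hupp _) (le_of_lt hε)

section OrnsteinUhlenbeck

variable {Ω : Type*} [MeasurableSpace Ω] {P : Measure Ω} [IsProbabilityMeasure P] {m : ℕ}
  {A : Matrix (Fin m) (Fin m) ℝ} {B : ℝ≥0 → Ω → EuclideanSpace ℝ (Fin m)}
  (hA : Commute (Matrix.toEuclideanCLM (𝕜 := ℝ) A) (Matrix.toEuclideanCLM (𝕜 := ℝ) A).adjoint)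
  (w : OrthonormalBasis (Fin m) ℝ (EuclideanSpace ℝ (Fin m))) {s : Fin m → ℝ}
  (hw : ∀ k, (Matrix.toEuclideanCLM (𝕜 := ℝ) A + (Matrix.toEuclideanCLM (𝕜 := ℝ) A).adjoint) (w k) =
    s k • w k)
  (hs : ∀ k, 0 < s k) (hB : IsStandardBrownian B P)
include hA hw hs hB

lemma IsOUSolution.map_eq_diagGaussian {x : EuclideanSpace ℝ (Fin m)}
    {X : ℝ≥0 → Ω → EuclideanSpace ℝ (Fin m)} (hX : IsOUSolution A 1 B P x X) (t : ℝ≥0) :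
    P.map (X t) = diagGaussian w (decayFlow (Matrix.toEuclideanCLM (𝕜 := ℝ) A) t x)
      fun k ↦ √((1 - Real.exp (-(s k * t))) / s k) := by
  have := Measure.isProbabilityMeasure_map (hX.aemeasurable t)
  refine eq_of_forall_map_inner_eq fun u ↦ ?_
  have hone : (Matrix.toEuclideanLin (1 : Matrix (Fin m) (Fin m) ℝ)).toContinuousLinearMap.adjoint =
      1 := by
    rw [Matrix.toEuclideanLin, Matrix.toLpLin_one]
    exact ContinuousLinearMap.adjoint_id
  have hvar : ∀ k, √((1 - Real.exp (-(s k * t))) / s k) ^ 2 = (1 - Real.exp (-(s k * t))) / s k :=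
    fun k ↦ Real.sq_sqrt (div_nonneg (sub_nonneg.2 (exp_neg_mul_le_one (hs k).le t.coe_nonneg))
      (hs k).le)
  rw [AEMeasurable.map_map_of_aemeasurable (by fun_prop) (hX.aemeasurable t)]
  refine (hX.hasLaw_inner hB t u).map_eq.trans ?_
  simp only [hone, one_apply_eq_self, (hasLaw_inner_diagGaussian w _ _ u).map_eq, mul_pow, hvar,
    integral_norm_decayFlow_sq (T := (Matrix.toEuclideanCLM (𝕜 := ℝ) A).adjoint)
      (by simpa using hA.symm) w (by simpa [add_comm] using hw) fun k ↦ (hs k).ne']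

lemma IsStationaryLaw.eq_diagGaussian
    {X : EuclideanSpace ℝ (Fin m) → ℝ≥0 → Ω → EuclideanSpace ℝ (Fin m)}
    (hX : ∀ y, IsOUSolution A 1 B P y (X y)) {μ : Measure (EuclideanSpace ℝ (Fin m))}
    (hμ : IsStationaryLaw P X μ) :
    μ = diagGaussian w 0 fun k ↦ √(1 / s k) := by
  have := hμ.isProbabilityMeasure
  have (t : ℝ≥0) (y : EuclideanSpace ℝ (Fin m)) : IsProbabilityMeasure (P.map (X y t)) :=
    Measure.isProbabilityMeasure_map ((hX y).aemeasurable t)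
  have htime : Tendsto ((↑) : ℝ≥0 → ℝ) atTop atTop := NNReal.tendsto_coe_atTop.2 tendsto_id
  refine eq_of_bind_eq_of_tendsto_lintegral (l := atTop) hμ.bind_eq fun y f ↦ ?_
  simp_rw [(hX y).map_eq_diagGaussian hA w hw hs hB]
  refine tendsto_lintegral_diagGaussian w _ _
    ((tendsto_decayFlow_apply_atTop hA w hw hs y).comp htime) (fun k ↦ ?_) f
  simpa using ((((tendsto_exp_neg_mul_atTop (hs k)).comp htime).const_sub 1).div_const (s k)).sqrt

lemma wasserstein_two_stationary {x : EuclideanSpace ℝ (Fin m)}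
    {X : EuclideanSpace ℝ (Fin m) → ℝ≥0 → Ω → EuclideanSpace ℝ (Fin m)}
    (hX : ∀ y, IsOUSolution A 1 B P y (X y)) {μ : Measure (EuclideanSpace ℝ (Fin m))}
    (hμ : IsStationaryLaw P X μ) (t : ℝ≥0) :
    wasserstein 2 (P.map (X x t)) μ =
      ENNReal.ofReal √(sqDistToEquilibrium s (fun k ↦ inner ℝ (w k) x) t) := by
  rw [sqDistToEquilibrium, (hX x).map_eq_diagGaussian hA w hw hs hB,
    hμ.eq_diagGaussian hA w hw hs hB hX,
    wasserstein_two_diagGaussian _ _ _ (fun _ ↦ Real.sqrt_nonneg _) fun _ ↦ Real.sqrt_nonneg _,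
    Finset.sum_add_distrib, Finset.sum_add_distrib, ← norm_decayFlow_sq_eq_sum hA w hw,
    ← w.sum_sq_inner_left]
  simp only [inner_zero_left, sub_zero]
  congr! 4 with k
  rw [Real.sqrt_div' _ (hs k).le, Real.sqrt_div' _ (hs k).le, ← sub_div, div_pow,
    Real.sq_sqrt (hs k).le, Real.sqrt_one, sub_sq_comm]

lemma cutoffStability_wasserstein_two {x : EuclideanSpace ℝ (Fin m)}
    {X : EuclideanSpace ℝ (Fin m) → ℝ≥0 → Ω → EuclideanSpace ℝ (Fin m)}
    (hX : ∀ y, IsOUSolution A 1 B P y (X y)) {μ : Measure (EuclideanSpace ℝ (Fin m))}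
    (hμ : IsStationaryLaw P X μ) {r : ℝ}
    (hr : IsLeast (cutoffRates (fun k ↦ s k / 2) {k | inner ℝ (w k) x ≠ 0}) r) :
    CutoffStability (fun t ↦ (wasserstein 2 (P.map (X x t)) μ).toReal)
      (fun ε ↦ 1 / r * |Real.log ε|) := by
  have hr₀ : 0 < r := by
    obtain ⟨k, rfl⟩ | ⟨k, -, rfl⟩ := hr.1
    · exact mul_pos two_pos (half_pos (hs k))
    · exact half_pos (hs k)
  obtain ⟨c, hc, hlow⟩ := exists_le_sqDistToEquilibrium hs hr.1
  have hsqrt (C : ℝ) (t : ℝ≥0) :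
      √(C * Real.exp (-(r * t)) ^ 2) = √C * Real.exp (-(r * t)) := by
    rw [Real.sqrt_mul' _ (sq_nonneg _), Real.sqrt_sq (Real.exp_pos _).le]
  refine cutoffStability_of_exp_bounds hr₀ (Real.sqrt_pos.2 hc)
    (C := √(∑ k, (inner ℝ (w k) x ^ 2 + 1 / s k))) (fun t ↦ ?_) fun t ↦ ?_ <;>
    rw [wasserstein_two_stationary hA w hw hs hB hX hμ, ENNReal.toReal_ofReal (Real.sqrt_nonneg _),
      ← hsqrt]
  · exact Real.sqrt_le_sqrt (hlow t t.coe_nonneg)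
  · exact Real.sqrt_le_sqrt (sqDistToEquilibrium_le hs hr.2 t.coe_nonneg)

end OrnsteinUhlenbeck

section ComplexCoord

variable {m : ℕ}

/-- The complex coordinate `⟨u, y⟩` of a real vector `y`, as a real-linear functional of `y`. -/
noncomputable def complexCoord (u : EuclideanSpace ℂ (Fin m)) : EuclideanSpace ℝ (Fin m) →L[ℝ] ℂ :=
  LinearMap.toContinuousLinearMap
    { toFun := fun y ↦ inner ℂ u (toComplexVec y)
      map_add' := fun y z ↦ by
        simp [PiLp.inner_apply, toComplexVec, add_mul, Finset.sum_add_distrib]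
      map_smul' := fun c y ↦ by simp [PiLp.inner_apply, toComplexVec, mul_assoc, Finset.mul_sum] }

lemma complexCoord_apply (u : EuclideanSpace ℂ (Fin m)) (y : EuclideanSpace ℝ (Fin m)) :
    complexCoord u y = inner ℂ u (toComplexVec y) := rfl

lemma complexCoord_single (u : EuclideanSpace ℂ (Fin m)) (i : Fin m) :
    complexCoord u (EuclideanSpace.single i 1) = star (u i) := by
  have : toComplexVec (EuclideanSpace.single i 1) = EuclideanSpace.single i 1 := by
    ext k
    by_cases h : k = i <;> simp [toComplexVec, h]
  simp [complexCoord_apply, this, EuclideanSpace.inner_single_right]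

lemma toComplexVec_zero : toComplexVec (0 : EuclideanSpace ℝ (Fin m)) = 0 := by
  ext
  simp [toComplexVec]

lemma inner_toComplexVec (x y : EuclideanSpace ℝ (Fin m)) :
    inner ℂ (toComplexVec x) (toComplexVec y) = (inner ℝ x y : ℝ) := by
  simp [PiLp.inner_apply, toComplexVec]

lemma sum_star_complexCoord_mul {ι : Type*} [Fintype ι]
    (v : OrthonormalBasis ι ℂ (EuclideanSpace ℂ (Fin m))) (x y : EuclideanSpace ℝ (Fin m)) :
    ∑ j, star (complexCoord (v j) x) * complexCoord (v j) y = (inner ℝ x y : ℝ) := by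
  rw [← inner_toComplexVec, ← v.sum_inner_mul_inner]
  exact Finset.sum_congr rfl fun j _ ↦ by rw [← inner_conj_symm _ (v j)]; rfl

lemma exists_complexCoord_ne_zero {u : EuclideanSpace ℂ (Fin m)} (hu : u ≠ 0) :
    ∃ y, complexCoord u y ≠ 0 := by
  contrapose! hu
  ext i
  simpa [complexCoord_single] using hu (EuclideanSpace.single i 1)

lemma exists_complexCoord_ne_zero_of_inner_ne_zero {ι : Type*} [Fintype ι]
    (v : OrthonormalBasis ι ℂ (EuclideanSpace ℂ (Fin m))) {x y : EuclideanSpace ℝ (Fin m)}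
    (h : inner ℝ x y ≠ 0) : ∃ j, complexCoord (v j) x ≠ 0 ∧ complexCoord (v j) y ≠ 0 := by
  rw [← Complex.ofReal_ne_zero, ← sum_star_complexCoord_mul v] at h
  obtain ⟨j, -, hj⟩ := Finset.exists_ne_zero_of_sum_ne_zero h
  exact ⟨j, star_ne_zero.1 (left_ne_zero_of_mul hj), right_ne_zero_of_mul hj⟩

lemma exists_inner_ne_zero_of_complexCoord_ne_zero {ι : Type*} [Fintype ι]
    (w : OrthonormalBasis ι ℝ (EuclideanSpace ℝ (Fin m))) {u : EuclideanSpace ℂ (Fin m)}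
    {y : EuclideanSpace ℝ (Fin m)} (h : complexCoord u y ≠ 0) :
    ∃ k, inner ℝ (w k) y ≠ 0 ∧ complexCoord u (w k) ≠ 0 := by
  rw [← w.sum_repr' y, map_sum] at h
  obtain ⟨k, -, hk⟩ := Finset.exists_ne_zero_of_sum_ne_zero h
  rw [map_smul] at hk
  exact ⟨k, (smul_ne_zero_iff.1 hk).1, (smul_ne_zero_iff.1 hk).2⟩

lemma eq_of_forall_complexCoord_eq {ι : Type*} [Fintype ι]
    (v : OrthonormalBasis ι ℂ (EuclideanSpace ℂ (Fin m))) {x y : EuclideanSpace ℝ (Fin m)}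
    (h : ∀ j, complexCoord (v j) x = complexCoord (v j) y) : x = y := by
  by_contra hxy
  obtain ⟨j, hj, -⟩ := exists_complexCoord_ne_zero_of_inner_ne_zero v
    (inner_self_ne_zero.2 (sub_ne_zero.2 hxy) : inner ℝ (x - y) (x - y) ≠ 0)
  exact hj (by rw [map_sub, h, sub_self])

end ComplexCoord

section Eigenvectors

variable {m : ℕ} {A : Matrix (Fin m) (Fin m) ℝ} {ι : Type*} [Fintype ι] {l : ι → ℂ}
  {v : OrthonormalBasis ι ℂ (EuclideanSpace ℂ (Fin m))}

lemma toEuclideanLin_map_toComplexVec (A : Matrix (Fin m) (Fin m) ℝ)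
    (y : EuclideanSpace ℝ (Fin m)) :
    (A.map (fun a : ℝ ↦ (a : ℂ))).toEuclideanLin (toComplexVec y) =
      toComplexVec (Matrix.toEuclideanCLM (𝕜 := ℝ) A y) := by
  ext i
  simp [toComplexVec, Matrix.mulVec, dotProduct]

lemma adjoint_toEuclideanCLM (A : Matrix (Fin m) (Fin m) ℝ) :
    (Matrix.toEuclideanCLM (𝕜 := ℝ) A).adjoint = Matrix.toEuclideanCLM (𝕜 := ℝ) Aᵀ := by
  rw [← ContinuousLinearMap.star_eq_adjoint, ← map_star, Matrix.star_eq_conjTranspose,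
    Matrix.conjTranspose_eq_transpose_of_trivial]

lemma complexCoord_adjoint_apply {u : EuclideanSpace ℂ (Fin m)} {c : ℂ}
    (hu : (A.map (fun a : ℝ ↦ (a : ℂ))).toEuclideanLin u = c • u) (y : EuclideanSpace ℝ (Fin m)) :
    complexCoord u ((Matrix.toEuclideanCLM (𝕜 := ℝ) A).adjoint y) = star c * complexCoord u y := by
  have hstar : Aᵀ.map (fun a : ℝ ↦ (a : ℂ)) = (A.map (fun a : ℝ ↦ (a : ℂ)))ᴴ := by
    ext
    simp
  rw [adjoint_toEuclideanCLM, complexCoord_apply, ← toEuclideanLin_map_toComplexVec, hstar,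
    Matrix.toEuclideanLin_conjTranspose_eq_adjoint, LinearMap.adjoint_inner_right, hu,
    inner_smul_left]
  rfl

variable (hv : ∀ j, (A.map (fun a : ℝ ↦ (a : ℂ))).toEuclideanLin (v j) = l j • v j)
include hv

lemma complexCoord_apply_of_eigenbasis (j : ι) (y : EuclideanSpace ℝ (Fin m)) :
    complexCoord (v j) (Matrix.toEuclideanCLM (𝕜 := ℝ) A y) = l j * complexCoord (v j) y := by
  classical
  rw [complexCoord_apply, ← toEuclideanLin_map_toComplexVec]
  conv_lhs => rw [← v.sum_repr' (toComplexVec y)]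
  simp [hv, orthonormal_iff_ite.1 v.orthonormal, complexCoord_apply, mul_comm]

lemma commute_adjoint_of_eigenbasis :
    Commute (Matrix.toEuclideanCLM (𝕜 := ℝ) A) (Matrix.toEuclideanCLM (𝕜 := ℝ) A).adjoint := by
  ext1 y
  refine eq_of_forall_complexCoord_eq v fun j ↦ ?_
  simp only [mul_apply_eq_comp, complexCoord_apply_of_eigenbasis hv,
    complexCoord_adjoint_apply (hv j)]
  ring

lemma half_eigenvalue_add_adjoint_eq {c : ℝ} {y : EuclideanSpace ℝ (Fin m)} {j : ι}
    (hy : (Matrix.toEuclideanCLM (𝕜 := ℝ) A + (Matrix.toEuclideanCLM (𝕜 := ℝ) A).adjoint) y = c • y)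
    (hj : complexCoord (v j) y ≠ 0) : c / 2 = (l j).re := by
  have h := congrArg (complexCoord (v j)) hy
  rw [add_apply, map_add, complexCoord_apply_of_eigenbasis hv, complexCoord_adjoint_apply (hv j),
    map_smul, ← add_mul, Complex.real_smul] at h
  have hre := congrArg Complex.re (mul_right_cancel₀ hj h)
  rw [Complex.ofReal_re, Complex.add_re, Complex.star_def, Complex.conj_re] at hre
  linarith

lemma exists_half_eigenvalue_add_adjoint_eq {c : ℝ} {y : EuclideanSpace ℝ (Fin m)}
    (hy : (Matrix.toEuclideanCLM (𝕜 := ℝ) A + (Matrix.toEuclideanCLM (𝕜 := ℝ) A).adjoint) y = c • y)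
    (hy₀ : y ≠ 0) : ∃ j, c / 2 = (l j).re := by
  obtain ⟨j, hj, -⟩ := exists_complexCoord_ne_zero_of_inner_ne_zero v (inner_self_ne_zero.2 hy₀)
  exact ⟨j, half_eigenvalue_add_adjoint_eq hv hy hj⟩

lemma cutoffRates_eq_of_eigenbasis {κ : Type*} [Fintype κ]
    (w : OrthonormalBasis κ ℝ (EuclideanSpace ℝ (Fin m))) {s : κ → ℝ}
    (hw : ∀ k, (Matrix.toEuclideanCLM (𝕜 := ℝ) A + (Matrix.toEuclideanCLM (𝕜 := ℝ) A).adjoint)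
      (w k) = s k • w k) (x : EuclideanSpace ℝ (Fin m)) :
    cutoffRates (fun k ↦ s k / 2) {k | inner ℝ (w k) x ≠ 0} =
      cutoffRates (fun j ↦ (l j).re) {j | complexCoord (v j) x ≠ 0} := by
  refine Set.Subset.antisymm ?_ ?_
  · rintro _ (⟨k, rfl⟩ | ⟨k, hk, rfl⟩)
    · obtain ⟨j, hj⟩ := exists_half_eigenvalue_add_adjoint_eq hv (hw k) (w.orthonormal.ne_zero k)
      exact Or.inl ⟨j, congrArg (2 * ·) hj.symm⟩
    · obtain ⟨j, hjk, hjx⟩ := exists_complexCoord_ne_zero_of_inner_ne_zero v hk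
      exact Or.inr ⟨j, hjx, (half_eigenvalue_add_adjoint_eq hv (hw k) hjk).symm⟩
  · rintro _ (⟨j, rfl⟩ | ⟨j, hj, rfl⟩)
    · obtain ⟨y, hy⟩ := exists_complexCoord_ne_zero (v.orthonormal.ne_zero j)
      obtain ⟨k, -, hk⟩ := exists_inner_ne_zero_of_complexCoord_ne_zero w hy
      exact Or.inl ⟨k, congrArg (2 * ·) (half_eigenvalue_add_adjoint_eq hv (hw k) hk)⟩
    · obtain ⟨k, hkx, hk⟩ := exists_inner_ne_zero_of_complexCoord_ne_zero w hj
      exact Or.inr ⟨k, hkx, half_eigenvalue_add_adjoint_eq hv (hw k) hk⟩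

end Eigenvectors

lemma exists_eigenbasis_add_adjoint {m : ℕ} {E : Type*} [NormedAddCommGroup E]
    [InnerProductSpace ℝ E] [FiniteDimensional ℝ E] (hm : Module.finrank ℝ E = m) (T : E →L[ℝ] E) :
    ∃ (w : OrthonormalBasis (Fin m) ℝ E) (s : Fin m → ℝ),
      ∀ k, (T + T.adjoint) (w k) = s k • w k := by
  have hsymm : ((T + T.adjoint : E →L[ℝ] E) : E →ₗ[ℝ] E).IsSymmetric :=
    ContinuousLinearMap.isSelfAdjoint_iff_isSymmetric.1 (IsSelfAdjoint.add_star_self T)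
  exact ⟨hsymm.eigenvectorBasis hm, hsymm.eigenvalues hm, hsymm.apply_eigenvectorBasis hm⟩

lemma corollary3_general {Ω : Type*} [MeasurableSpace Ω] (P : Measure Ω) [IsProbabilityMeasure P]
    {m : ℕ} {ι : Type*} [Fintype ι] (A : Matrix (Fin m) (Fin m) ℝ) (l : ι → ℂ)
    (v : OrthonormalBasis ι ℂ (EuclideanSpace ℂ (Fin m)))
    (hv : ∀ j, (A.map (fun a : ℝ ↦ (a : ℂ))).toEuclideanLin (v j) = l j • v j)
    (hpos : ∀ j, 0 < (l j).re) (B : ℝ≥0 → Ω → EuclideanSpace ℝ (Fin m))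
    (hB : IsStandardBrownian B P)
    (X : EuclideanSpace ℝ (Fin m) → ℝ≥0 → Ω → EuclideanSpace ℝ (Fin m))
    (hX : ∀ y, IsOUSolution A (1 : Matrix (Fin m) (Fin m) ℝ) B P y (X y))
    (μ : Measure (EuclideanSpace ℝ (Fin m))) (hμ : IsStationaryLaw P X μ)
    (x : EuclideanSpace ℝ (Fin m)) :
    (∀ t, wasserstein 2 (P.map (X x t)) μ ≠ ∞) ∧
    ∀ r, IsLeast (cutoffRates (fun j ↦ (l j).re) {j | inner ℂ (toComplexVec x) (v j) ≠ 0}) r →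
      CutoffStability (fun t ↦ (wasserstein 2 (P.map (X x t)) μ).toReal)
        (fun ε ↦ 1 / r * |Real.log ε|) := by
  have hA := commute_adjoint_of_eigenbasis hv
  obtain ⟨w, s, hw⟩ :=
    exists_eigenbasis_add_adjoint finrank_euclideanSpace_fin (Matrix.toEuclideanCLM (𝕜 := ℝ) A)
  have hs (k : Fin m) : 0 < s k := by
    obtain ⟨j, hj⟩ := exists_half_eigenvalue_add_adjoint_eq hv (hw k) (w.orthonormal.ne_zero k)
    linarith [hpos j]
  refine ⟨fun t ↦ ?_, fun r hr ↦ cutoffStability_wasserstein_two hA w hw hs hB hX hμ ?_⟩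
  · rw [wasserstein_two_stationary hA w hw hs hB hX hμ]
    exact ENNReal.ofReal_ne_top
  · simpa only [cutoffRates_eq_of_eigenbasis hv w hw, complexCoord_apply, ne_eq,
      inner_eq_zero_symm (x := v _)] using hr

theorem corollary3 {Ω : Type*} [MeasurableSpace Ω] (P : Measure Ω) [IsProbabilityMeasure P]
    {m : ℕ} [NeZero m]
    -- the drift matrix: normal, with eigenvalues `l j` and orthonormal eigenvectors `v j`
    (A : Matrix (Fin m) (Fin m) ℝ) (hA : A * Aᵀ = Aᵀ * A)
    (l : Fin m → ℂ) (v : OrthonormalBasis (Fin m) ℂ (EuclideanSpace ℂ (Fin m)))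
    (hv : ∀ j, (A.map (fun a : ℝ ↦ (a : ℂ))).toEuclideanLin (v j) = l j • v j)
    (hl : Monotone (fun j ↦ (l j).re)) (hpos : 0 < (l 0).re)
    -- the Ornstein-Uhlenbeck process with dispersion matrix the identity, from every initial value
    (B : ℝ≥0 → Ω → EuclideanSpace ℝ (Fin m)) (hB : IsStandardBrownian B P)
    (X : EuclideanSpace ℝ (Fin m) → ℝ≥0 → Ω → EuclideanSpace ℝ (Fin m))
    (hX : ∀ y, IsOUSolution A (1 : Matrix (Fin m) (Fin m) ℝ) B P y (X y))
    -- its equilibrium distribution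
    (μ : Measure (EuclideanSpace ℝ (Fin m))) (hμ : IsStationaryLaw P X μ)
    (x : EuclideanSpace ℝ (Fin m)) :
    (∀ t, wasserstein 2 (P.map (X x t)) μ ≠ ∞) ∧
    (x ≠ 0 → inner ℂ (toComplexVec x) (v 0) ≠ 0 →
      CutoffStability (fun t ↦ (wasserstein 2 (P.map (X x t)) μ).toReal)
        (fun ε ↦ 1 / (l 0).re * |Real.log ε|)) ∧
    (x ≠ 0 → inner ℂ (toComplexVec x) (v 0) = 0 →
      ∀ ρ : ℝ, IsLeast {r : ℝ | ∃ j, inner ℂ (toComplexVec x) (v j) ≠ 0 ∧ (l j).re = r} ρ →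
      ρ < 2 * (l 0).re →
      CutoffStability (fun t ↦ (wasserstein 2 (P.map (X x t)) μ).toReal)
        (fun ε ↦ 1 / ρ * |Real.log ε|)) ∧
    (x = 0 →
      CutoffStability (fun t ↦ (wasserstein 2 (P.map (X x t)) μ).toReal)
        (fun ε ↦ 1 / (2 * (l 0).re) * |Real.log ε|)) := by
  have hmin (j : Fin m) : (l 0).re ≤ (l j).re := hl (Fin.zero_le j)
  obtain ⟨hfin, hcutoff⟩ :=
    corollary3_general P A l v hv (fun j ↦ hpos.trans_le (hmin j)) B hB X hX μ hμ x
  exact ⟨hfin, fun _ h₀ ↦ hcutoff _ (isLeast_cutoffRates_of_mem h₀ hmin hpos.le),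
    fun _ _ ρ hρ hlt ↦ hcutoff ρ (isLeast_cutoffRates hρ fun j ↦ by linarith [hmin j]),
    fun hx ↦ hcutoff _ (by simpa [hx, toComplexVec_zero] using
      isLeast_cutoffRates_empty (ρ := fun j ↦ (l j).re) hmin)⟩
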